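/- Let $\mathbb I=[0,1]$, let $Q=\mathbb I^{\mathbb N}$ be the Hilbert cube with coordinates numbered by $\mathbb N=\{1,2,3,\dots\}$, and let $\pi_i:Q\to\mathbb I$ be the projection onto the $i$-th coordinate. Definitions. A \emph{continuum} is a nonempty compact connected Hausdorff space. A compact Hausdorff space is \emph{hereditarily indecomposable} if, whenever two continua in it meet, one of them is contained in the other. A closed set $L$ is a \emph{partition} between $A$ and $B$ if its complement is the union of two disjoint open sets, one containing $A$ and the other containing $B$. A family $\{(A_j,B_j):j\in J\}$ of pairs of disjoint closed sets is \emph{essential} if $\bigcap_{j\in J}L_j\neq\emptyset$ for every choice of partitions $L_j$ between $A_j$ and $B_j$. A compact Hausdorff space is \emph{infinite-dimensional} if it has an essential family of every finite cardinality $n$, and \emph{strongly infinite-dimensional} if it has an infinite essential family. A \emph{pliable foursome} in a space is a quadruple $(C,D,F,G)$ of closed sets with $C\cap D=C\cap F=D\cap G=\emptyset$. A family $\mathcal F$ of continuous functions from a space to $\mathbb I$ is \emph{pliable} if for every pliable foursome $(C,D,F,G)$ with $C,D\ne\emptyset$ there is an $f\in\mathcal F$ with $f[C]=\{0\}$, $f[G]\subseteq[0,\frac12]$,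 $f[F]\subseteq[\frac12,1]$ and $f[D]=\{1\}$. Fix numbers $0<y_1<y_2<\frac12<y_3<y_4<1$, and let $P\subseteq\mathbb I^2$ be the crooked partition with these levels, that is, the closure of the union of the five open rectangles $$(\tfrac17,\tfrac27)\times(0,y_4),\quad(\tfrac17,\tfrac47)\times(y_3,y_4),\quad(\tfrac37,\tfrac47)\times(y_1,y_4),\quad(\tfrac37,\tfrac67)\times(y_1,y_2),\quad(\tfrac57,\tfrac67)\times(y_1,1).$$ Theorem. Let $\{f_i:i\in\mathbb N\}$ be a pliable family of continuous functions for $Q$, let $u_i:Q\to\mathbb I^2$ be the map $u_i(x)=(\pi_{2i}(x),f_i(x))$, and let $X=\bigcap_{i=1}^\infty u_i^{-1}[P]$. Then $X$ is an infinite-dimensional hereditarily indecomposable compact space. Moreover, the traces of the odd-numbered faces, $$\bigl\{(\{x\in X:x_k=0\},\{x\in X:x_k=1\}):k\in\mathbb N\text{ odd}\bigr\},$$ form an essential family in $X$; so $X$ is even strongly infinite-dimensional. -/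

import Mathlib

open Set unitInterval

/-- `L` is a partition between `A` and `B` in `X`: a closed set whose complement is the union
of two disjoint open sets, one containing `A`, the other containing `B`. -/
def IsPartitionBetween {X : Type*} [TopologicalSpace X] (L A B : Set X) : Prop :=
  IsClosed L ∧ ∃ U V : Set X, IsOpen U ∧ IsOpen V ∧ Disjoint U V ∧ A ⊆ U ∧ B ⊆ V ∧ Lᶜ = U ∪ V

/-- The family of pairs `(A i, B i)` is essential: the pairs consist of disjoint closed sets, and
whenever `L i` is a partition between `A i` and `B i` for all `i`, the intersection of all `L i`
is nonempty. -/
def IsEssentialFamily {X : Type*} [TopologicalSpace X] {ι : Type*} (A B : ι → Set X) : Prop :=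
  (∀ i, IsClosed (A i) ∧ IsClosed (B i) ∧ Disjoint (A i) (B i)) ∧
    ∀ L : ι → Set X, (∀ i, IsPartitionBetween (L i) (A i) (B i)) → (⋂ i, L i).Nonempty

/-- `dim X = ∞`: there are essential families of every finite cardinality. -/
def InfiniteDimensional (X : Type*) [TopologicalSpace X] : Prop :=
  ∀ n : ℕ, ∃ A B : Fin n → Set X, IsEssentialFamily A B

/-- `X` possesses an infinite essential family. -/
def StronglyInfiniteDimensional.{u} (X : Type u) [TopologicalSpace X] : Prop :=
  ∃ (ι : Type u) (A B : ι → Set X), Infinite ι ∧ IsEssentialFamily A B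

/-- A hereditarily indecomposable compact Hausdorff space: whenever two continua in the space
meet, one is contained in the other. (`IsConnected` includes being nonempty.) -/
def HereditarilyIndecomposable (X : Type*) [TopologicalSpace X] : Prop :=
  CompactSpace X ∧ T2Space X ∧
    ∀ K L : Set X, IsCompact K → IsConnected K → IsCompact L → IsConnected L →
      (K ∩ L).Nonempty → K ⊆ L ∨ L ⊆ K

/-- Four closed sets `C`, `D`, `F`, `G` with `C ∩ D = C ∩ F = D ∩ G = ∅`. -/
def IsPliableFoursome {X : Type*} [TopologicalSpace X] (C D F G : Set X) : Prop :=
  IsClosed C ∧ IsClosed D ∧ IsClosed F ∧ IsClosed G ∧ C ∩ D = ∅ ∧ C ∩ F = ∅ ∧ D ∩ G = ∅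

/-- `f` is a Urysohn function for the foursome `(C, D, F, G)`. -/
def IsUrysohnFunction {X : Type*} [TopologicalSpace X] (f : C(X, I)) (C D F G : Set X) : Prop :=
  f '' C = {0} ∧ (∀ x ∈ G, (f x : ℝ) ≤ 1 / 2) ∧ (∀ x ∈ F, 1 / 2 ≤ (f x : ℝ)) ∧ f '' D = {1}

/-- A pliable family for `X`: it contains a Urysohn function for every pliable foursome
`(C, D, F, G)` with `C` and `D` nonempty (the images of `C` and `D` have to be the one-point sets
`{0}` and `{1}`). -/
def IsPliableFamily {X : Type*} [TopologicalSpace X] {ι : Type*} (f : ι → C(X, I)) : Prop :=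
  ∀ C D F G : Set X, IsPliableFoursome C D F G → C.Nonempty → D.Nonempty →
    ∃ i, IsUrysohnFunction (f i) C D F G

/-- The point `k / 7` of the unit interval. -/
noncomputable def seventh (k : Fin 8) : I :=
  ⟨((k : ℕ) : ℝ) / 7, by positivity, by
    have h : ((k : ℕ) : ℝ) ≤ 7 := by exact_mod_cast Nat.lt_succ_iff.mp k.isLt
    rw [div_le_one (by norm_num)]; exact h⟩

/-- The crooked partition of the square: the closure of the union of five open rectangles that
together form an N-shaped band. The band rises from the bottom edge over `(1/7, 2/7)` to the
height `y₄`, goes right at heights `(y₃, y₄)`, descends over `(3/7, 4/7)` to the height `y₁`, goes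
right at heights `(y₁, y₂)`, and rises over `(5/7, 6/7)` to the top edge. -/
def crookedPartition (y₁ y₂ y₃ y₄ : I) : Set (I × I) :=
  closure
    (Ioo (seventh 1) (seventh 2) ×ˢ Ioo 0 y₄ ∪
     Ioo (seventh 1) (seventh 4) ×ˢ Ioo y₃ y₄ ∪
     Ioo (seventh 3) (seventh 4) ×ˢ Ioo y₁ y₄ ∪
     Ioo (seventh 3) (seventh 6) ×ˢ Ioo y₁ y₂ ∪
     Ioo (seventh 5) (seventh 6) ×ˢ Ioo y₁ 1)

/-- The Hilbert cube, with coordinates numbered by the positive integers. -/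
abbrev HilbertCube : Type := ℕ+ → I

/-- The diagonal map of the projection onto the coordinate `2 * i` and `f i`. -/
def diagMap (f : ℕ+ → C(HilbertCube, I)) (i : ℕ+) : HilbertCube → I × I :=
  fun x => (x (2 * i), f i x)

/-- The intersection over all `i ≥ 1` of the preimages of `P` under the diagonal maps. -/
def bingCompactum (P : Set (I × I)) (f : ℕ+ → C(HilbertCube, I)) : Set HilbertCube :=
  ⋂ i : ℕ+, diagMap f i ⁻¹' P

/-- The trace on `Y` of the face where the coordinate `k` is `0`. -/
def faceZeroTrace (Y : Set HilbertCube) (k : ℕ+) : Set Y := {x | x.1 k = 0}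

/-- The trace on `Y` of the face where the coordinate `k` is `1`. -/
def faceOneTrace (Y : Set HilbertCube) (k : ℕ+) : Set Y := {x | x.1 k = 1}

/-!
Let `x` be a point of `X` with `π_{2i} x = s` and `f_i x = t`; then `(s, t)` lies on the N-shaped
band `P`. If continua `K` and `L` meet and neither contains the other, pick `p ∈ K \ L` and
`q ∈ L \ K`. Some `f_i` is `0` at `p`, at most `1/2` on `K`, at least `1/2` on `L`, and `1` at `q`.
Below height `y₃` the band splits over the gap `(2/7, 3/7)`, so the connected set `K` stays on the
side of `p`, the left one; above `y₂` it splits over `(4/7, 5/7)`, so `L` stays on the right. Hence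
`K` and `L` are disjoint after all.

As `P` separates the vertical edges of the square, `u_i⁻¹[P]` is a partition between the faces
`x_{2i} = 0` and `x_{2i} = 1` of the Hilbert cube. Partitions in the closed subspace `X` extend to
partitions in `Q`, so the odd faces are essential in `X` because all faces are essential in `Q`.

For the faces of a finite cube this is proved by a discrete Stokes theorem on a fine grid. Let `u_a`
be the mod 2 indicator of the complement of the open set that contains `x_a = 0`. The integral of
`du_{a₁} ∪ ⋯ ∪ du_{aₙ}` over the grid reduces, one boundary face at a time, to `1`. So the product
is nonzero on some small cube, on which no `u_a` is then constant; in the limit these cubes converge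
to a point of all partitions.
-/

theorem sum_sum_erase_eq_zero_of_comm {ι R : Type*} [DecidableEq ι] [Semiring R] [CharP R 2]
    {f : ι → ι → R} (hf : ∀ a b, f a b = f b a) (T : Finset ι) :
    ∑ a ∈ T, ∑ b ∈ T.erase a, f a b = 0 := by
  rw [Finset.sum_sigma']
  refine Finset.sum_involution (fun p _ => ⟨p.2, p.1⟩) ?_ ?_ ?_ ?_
  · intro p _
    rw [hf p.1 p.2]
    exact CharTwo.add_self_eq_zero _
  · rintro ⟨a, b⟩ hab _ h
    simp only [Finset.mem_sigma, Finset.mem_erase, Sigma.mk.injEq] at hab h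
    exact hab.2.1 h.1
  · rintro ⟨a, b⟩ hab
    simp only [Finset.mem_sigma, Finset.mem_erase] at hab ⊢
    exact ⟨hab.2.2, hab.2.1.symm, hab.1⟩
  · exact fun _ _ => rfl

/-- A mod 2 cubical cochain on the grid `ι → ℕ`: `c T v` is its value on the unit cube with lowest
vertex `v` and set of directions `T`, hence of dimension `#T`. -/
abbrev GridCochain (ι : Type*) : Type _ := Finset ι → (ι → ℕ) → ZMod 2

namespace GridCochain

variable {ι : Type*} [DecidableEq ι]

/-- The coboundary of a mod 2 cochain: its value on a cube is the sum of the values of the cochain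
on all facets. The signs, irrelevant mod 2, make the sums along a coordinate telescope. -/
def coboundary (c : GridCochain ι) : GridCochain ι := fun T v =>
  ∑ a ∈ T, (c (T.erase a) (v + Pi.single a 1) - c (T.erase a) v)

theorem coboundary_coboundary (c : GridCochain ι) : c.coboundary.coboundary = 0 := by
  funext T v
  simp only [coboundary, ← Finset.sum_sub_distrib, Pi.zero_apply]
  refine sum_sum_erase_eq_zero_of_comm (f := fun a b =>
    c ((T.erase a).erase b) (v + Pi.single a 1 + Pi.single b 1) -
      c ((T.erase a).erase b) (v + Pi.single a 1) -
      (c ((T.erase a).erase b) (v + Pi.single b 1) - c ((T.erase a).erase b) v)) (fun a b => ?_) T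
  rw [Finset.erase_right_comm, add_right_comm]
  abel

theorem coboundary_mul (u : (ι → ℕ) → ZMod 2) (c : GridCochain ι) (T : Finset ι) (v : ι → ℕ) :
    coboundary (fun S => u * c S) T v =
      ∑ a ∈ T, (u (v + Pi.single a 1) - u v) * c (T.erase a) (v + Pi.single a 1) +
        u v * c.coboundary T v := by
  simp only [coboundary, Pi.mul_apply, Finset.mul_sum, ← Finset.sum_add_distrib]
  exact Finset.sum_congr rfl fun a _ => by ring

/-- The product `du_{a₁} ∪ ⋯ ∪ du_{aₙ}` for a list `a₁, …, aₙ`. Since the product `ω` of the later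
factors is closed, `du_a ∪ ω` equals `d (u_a · ω)`, which serves as the recursion and avoids cup
products. -/
def coboundaryProduct (u : ι → (ι → ℕ) → ZMod 2) : List ι → GridCochain ι
  | [] => 1
  | a :: l => coboundary fun T => u a * coboundaryProduct u l T

theorem coboundary_coboundaryProduct (u : ι → (ι → ℕ) → ZMod 2) (l : List ι) :
    (coboundaryProduct u l).coboundary = 0 := by
  cases l with
  | nil => funext T v; simp [coboundary, coboundaryProduct]
  | cons a l => exact coboundary_coboundary _

theorem coboundaryProduct_cons (u : ι → (ι → ℕ) → ZMod 2) (a : ι) (l : List ι) (T : Finset ι)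
    (v : ι → ℕ) :
    coboundaryProduct u (a :: l) T v =
      ∑ b ∈ T, (u a (v + Pi.single b 1) - u a v) *
        coboundaryProduct u l (T.erase b) (v + Pi.single b 1) := by
  rw [coboundaryProduct, coboundary_mul, coboundary_coboundaryProduct, Pi.zero_apply,
    Pi.zero_apply, mul_zero, add_zero]

/-- The vertices of the unit cube with lowest vertex `v` and set of directions `T`. -/
def cube (T : Finset ι) (v : ι → ℕ) : Set (ι → ℕ) := Icc v (v + ∑ a ∈ T, Pi.single a 1)

theorem self_mem_cube (T : Finset ι) (v : ι → ℕ) : v ∈ cube T v := ⟨le_rfl, le_self_add⟩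

theorem cube_erase_subset {T : Finset ι} {b : ι} (hb : b ∈ T) (v : ι → ℕ) :
    cube (T.erase b) (v + Pi.single b 1) ⊆ cube T v := by
  refine Icc_subset_Icc le_self_add ?_
  rw [add_assoc, Finset.add_sum_erase T (fun a => Pi.single a 1) hb]

theorem apply_eq_of_mem_cube {T : Finset ι} {b : ι} (hb : b ∉ T) {v w : ι → ℕ} (hw : w ∈ cube T v) :
    w b = v b := by
  have h := hw.2 b
  simp only [Pi.add_apply, Finset.sum_apply, Finset.sum_pi_single, if_neg hb, add_zero] at h
  exact h.antisymm (hw.1 b)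

theorem exists_ne_of_coboundaryProduct_ne_zero {u : ι → (ι → ℕ) → ZMod 2} {l : List ι} {a : ι}
    (ha : a ∈ l) {T : Finset ι} {v : ι → ℕ} (h : coboundaryProduct u l T v ≠ 0) :
    ∃ w ∈ cube T v, ∃ w' ∈ cube T v, u a w ≠ u a w' := by
  induction l generalizing T v with
  | nil => simp at ha
  | cons d l ih =>
    rw [coboundaryProduct_cons] at h
    obtain ⟨b, hb, hne⟩ := Finset.exists_ne_zero_of_sum_ne_zero h
    have hsub := cube_erase_subset hb v
    rcases List.mem_cons.1 ha with rfl | ha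
    · exact ⟨_, hsub (self_mem_cube _ _), _, self_mem_cube _ _,
        sub_ne_zero.1 (left_ne_zero_of_mul hne)⟩
    · obtain ⟨w, hw, w', hw', hww'⟩ := ih ha (right_ne_zero_of_mul hne)
      exact ⟨w, hsub hw, w', hsub hw', hww'⟩

variable [Fintype ι]

/-- The lowest vertices of the unit cubes with set of directions `S` that tile the face of the grid
`{0, …, N} ^ ι` on which all coordinates outside `S` equal `N`. -/
def faceCorners (N : ℕ) (S : Finset ι) : Finset (ι → ℕ) :=
  Fintype.piFinset fun a => if a ∈ S then Finset.range N else {N}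

theorem mem_faceCorners {N : ℕ} {S : Finset ι} {v : ι → ℕ} :
    v ∈ faceCorners N S ↔ ∀ a, (a ∈ S → v a < N) ∧ (a ∉ S → v a = N) := by
  rw [faceCorners, Fintype.mem_piFinset]
  refine forall_congr' fun a => ?_
  split_ifs with ha <;> simp [ha]

theorem sum_faceCorners {M : Type*} [AddCommMonoid M] (N : ℕ) {S : Finset ι} {a : ι} (ha : a ∈ S)
    (g : (ι → ℕ) → M) :
    ∑ v ∈ faceCorners N S, g v =
      ∑ w ∈ faceCorners N (S.erase a), ∑ t ∈ Finset.range N, g (Function.update w a t) := by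
  rw [Finset.sum_sigma']
  refine Finset.sum_bij' (fun v _ => ⟨Function.update v a N, v a⟩)
    (fun p _ => Function.update p.1 a p.2) ?_ ?_ ?_ ?_ ?_
  all_goals simp only [Finset.mem_sigma, mem_faceCorners, Finset.mem_range, Finset.mem_erase]
  · grind
  · grind
  · simp
  · rintro ⟨w, t⟩ ⟨hw, -⟩
    have hwa : w a = N := (hw a).2 (by simp)
    simp [← hwa]
  · simp

theorem sum_coboundary (c : GridCochain ι) (N : ℕ) (S : Finset ι) :
    ∑ v ∈ faceCorners N S, c.coboundary S v =
      ∑ a ∈ S, ∑ w ∈ faceCorners N (S.erase a),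
        (c (S.erase a) w - c (S.erase a) (Function.update w a 0)) := by
  simp only [coboundary]
  rw [Finset.sum_comm]
  refine Finset.sum_congr rfl fun a ha => ?_
  rw [sum_faceCorners N ha]
  refine Finset.sum_congr rfl fun w hw => ?_
  have hwa : w a = N := (mem_faceCorners.1 hw a).2 (Finset.notMem_erase a S)
  have hstep (t : ℕ) : Function.update w a t + Pi.single a 1 = Function.update w a (t + 1) := by
    grind [Pi.add_apply]
  simp only [hstep]
  rw [Finset.sum_range_sub fun t => c (S.erase a) (Function.update w a t), ← hwa,
    Function.update_eq_self]

theorem sum_coboundaryProduct {u : ι → (ι → ℕ) → ZMod 2} {N : ℕ}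
    (h₀ : ∀ a v, v a = 0 → u a v = 0) (h₁ : ∀ a v, v a = N → u a v = 1) {l : List ι}
    (hl : l.Nodup) :
    ∑ v ∈ faceCorners N l.toFinset, coboundaryProduct u l l.toFinset v = 1 := by
  induction l with
  | nil => simp [faceCorners, coboundaryProduct]
  | cons a l ih =>
    obtain ⟨hal, hl⟩ := List.nodup_cons.1 hl
    -- On a face with `v b` constantly `0` or `N` the function `u b` is constant.
    have hvanish : ∀ b ∈ l, ∀ T, b ∉ T → ∀ v, v b = 0 ∨ v b = N →
        coboundaryProduct u l T v = 0 := by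
      intro b hb T hbT v hv
      by_contra hne
      obtain ⟨w, hw, w', hw', hww'⟩ := exists_ne_of_coboundaryProduct_ne_zero hb hne
      have := apply_eq_of_mem_cube hbT hw
      have := apply_eq_of_mem_cube hbT hw'
      grind
    have herase : (a :: l).toFinset.erase a = l.toFinset := by simp [hal]
    rw [coboundaryProduct, sum_coboundary, Finset.sum_eq_single_of_mem a (by simp), herase, ← ih hl]
    · refine Finset.sum_congr rfl fun w hw => ?_
      have hwa : w a = N := (mem_faceCorners.1 hw a).2 (by simpa)
      simp [h₁ a w hwa, h₀]
    · intro b hb hba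
      refine Finset.sum_eq_zero fun w hw => ?_
      have hbl : b ∈ l := by simpa [hba] using hb
      have hwb : w b = N := (mem_faceCorners.1 hw b).2 (Finset.notMem_erase b _)
      have hbS : b ∉ (a :: l).toFinset.erase b := Finset.notMem_erase b _
      rw [Pi.mul_apply, Pi.mul_apply, hvanish b hbl _ hbS _ (.inr hwb),
        hvanish b hbl _ hbS _ (.inl (Function.update_self b 0 w)), mul_zero, mul_zero, sub_zero]

end GridCochain

theorem exists_Icc_inter_nonempty_diff_nonempty {ι : Type*} [Finite ι] {N : ℕ}
    {A : ι → Set (ι → ℕ)} (h₀ : ∀ a v, v a = 0 → v ∉ A a) (h₁ : ∀ a v, v a = N → v ∈ A a) :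
    ∃ v, ∀ a, (Icc v (v + 1) ∩ A a).Nonempty ∧ (Icc v (v + 1) \ A a).Nonempty := by
  classical
  have := Fintype.ofFinite ι
  obtain ⟨v, -, hv⟩ := Finset.exists_ne_zero_of_sum_ne_zero
    ((GridCochain.sum_coboundaryProduct (u := fun a => (A a).indicator 1)
      (fun a v hv => indicator_of_notMem (h₀ a v hv) 1)
      (fun a v hv => indicator_of_mem (h₁ a v hv) 1) Finset.univ.nodup_toList).trans_ne one_ne_zero)
  refine ⟨v, fun a => ?_⟩
  obtain ⟨w, hw, w', hw', hne⟩ :=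
    GridCochain.exists_ne_of_coboundaryProduct_ne_zero (Finset.mem_toList.2 (Finset.mem_univ a)) hv
  rw [Finset.toList_toFinset, GridCochain.cube, Finset.univ_sum_single] at hw hw'
  by_cases hwA : w ∈ A a <;> by_cases hwA' : w' ∈ A a
  · simp [hwA, hwA'] at hne
  · exact ⟨⟨w, hw, hwA⟩, ⟨w', hw', hwA'⟩⟩
  · exact ⟨⟨w', hw', hwA'⟩, ⟨w, hw, hwA⟩⟩
  · simp [hwA, hwA'] at hne

theorem iInter_nonempty_of_forall_inter_ball_nonempty {X ι : Type*} [PseudoMetricSpace X]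
    [CompactSpace X] {F : ι → Set X} (hF : ∀ i, IsClosed (F i))
    (h : ∀ ε > 0, ∃ p, ∀ i, (F i ∩ Metric.ball p ε).Nonempty) : (⋂ i, F i).Nonempty := by
  choose p hp using fun n : ℕ => h (1 / (n + 1)) Nat.one_div_pos_of_nat
  obtain ⟨q, φ, hφ, hq⟩ := CompactSpace.tendsto_subseq p
  refine ⟨q, mem_iInter.2 fun i => ?_⟩
  choose x hxF hxp using fun n => hp (φ n) i
  have hdist : Filter.Tendsto (fun n => dist (p (φ n)) (x n)) Filter.atTop (nhds 0) :=
    squeeze_zero (fun _ => dist_nonneg) (fun n => (Metric.mem_ball'.1 (hxp n)).le)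
      (tendsto_one_div_add_atTop_nhds_zero_nat.comp hφ.tendsto_atTop)
  exact (hF i).mem_of_tendsto (tendsto_of_tendsto_of_dist hq hdist) (.of_forall hxF)

/-- The point of the cube `[0, 1] ^ ι` that corresponds to the vertex `v` of the grid
`{0, …, N} ^ ι`. Coordinates above `N` are sent to `1`. -/
noncomputable def gridPoint {ι : Type*} (N : ℕ) (v : ι → ℕ) : ι → I :=
  fun a => projIcc 0 1 zero_le_one (v a / N : ℝ)

theorem gridPoint_apply_eq_zero {ι : Type*} {N : ℕ} {v : ι → ℕ} {a : ι} (h : v a = 0) :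
    gridPoint N v a = 0 := by
  rw [gridPoint, h, Nat.cast_zero, zero_div]
  exact projIcc_left _

theorem gridPoint_apply_eq_one {ι : Type*} {N : ℕ} (hN : N ≠ 0) {v : ι → ℕ} {a : ι} (h : v a = N) :
    gridPoint N v a = 1 := by
  rw [gridPoint, h, div_self (Nat.cast_ne_zero.2 hN)]
  exact projIcc_right _

theorem dist_gridPoint_le {ι : Type*} [Fintype ι] {N : ℕ} {v w : ι → ℕ} (h : w ∈ Icc v (v + 1)) :
    dist (gridPoint N w) (gridPoint N v) ≤ 1 / N := by
  refine (dist_pi_le_iff (by positivity)).2 fun a => ?_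
  have hle : (v a : ℝ) ≤ w a := mod_cast h.1 a
  have hle' : (w a : ℝ) ≤ v a + 1 := mod_cast h.2 a
  calc dist (gridPoint N w a) (gridPoint N v a)
      ≤ 1 * dist (w a / N : ℝ) (v a / N) := (LipschitzWith.projIcc zero_le_one).dist_le_mul _ _
    _ = |(w a : ℝ) - v a| / N := by
        rw [one_mul, Real.dist_eq, ← sub_div, abs_div, Nat.abs_cast]
    _ ≤ 1 / N := by
        gcongr
        rw [abs_of_nonneg (sub_nonneg.2 hle)]
        linarith

theorem isClosed_isClosed_disjoint_faces {ι : Type*} (k : ι) :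
    IsClosed {x : ι → I | x k = 0} ∧ IsClosed {x : ι → I | x k = 1} ∧
      Disjoint {x : ι → I | x k = 0} {x | x k = 1} :=
  ⟨isClosed_singleton.preimage (continuous_apply k), isClosed_singleton.preimage
    (continuous_apply k), disjoint_left.2 fun _ h₀ h₁ => zero_ne_one (h₀.symm.trans h₁)⟩

namespace IsPartitionBetween

variable {X : Type*} [TopologicalSpace X]

theorem compl_union {U V A B : Set X} (hU : IsOpen U) (hV : IsOpen V) (hUV : Disjoint U V)
    (hA : A ⊆ U) (hB : B ⊆ V) : IsPartitionBetween (U ∪ V)ᶜ A B :=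
  ⟨(hU.union hV).isClosed_compl, U, V, hU, hV, hUV, hA, hB, compl_compl _⟩

theorem preimage {Y : Type*} [TopologicalSpace Y] {L A B : Set Y} (h : IsPartitionBetween L A B)
    {g : X → Y} (hg : Continuous g) : IsPartitionBetween (g ⁻¹' L) (g ⁻¹' A) (g ⁻¹' B) := by
  obtain ⟨hL, U, V, hU, hV, hUV, hA, hB, hLc⟩ := h
  exact ⟨hL.preimage hg, g ⁻¹' U, g ⁻¹' V, hU.preimage hg, hV.preimage hg, hUV.preimage g,
    preimage_mono hA, preimage_mono hB, by rw [← preimage_compl, hLc, preimage_union]⟩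

theorem exists_of_normalSpace [NormalSpace X] {A B : Set X} (hA : IsClosed A) (hB : IsClosed B)
    (hAB : Disjoint A B) : ∃ L, IsPartitionBetween L A B := by
  obtain ⟨U, V, hU, hV, hAU, hBV, hUV⟩ := normal_separation hA hB hAB
  exact ⟨_, compl_union hU hV hUV hAU hBV⟩

theorem disjoint_closure_image_val_union {Y A B : Set X} (hY : IsClosed Y) (hA : IsClosed A)
    (hAB : Disjoint A B) {U V : Set Y} (hV : IsOpen V) (hUV : Disjoint U V)
    (hAU : Subtype.val ⁻¹' A ⊆ U) (hBV : Subtype.val ⁻¹' B ⊆ V) :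
    Disjoint (closure (Subtype.val '' U ∪ A)) (Subtype.val '' V ∪ B) := by
  have hclosure : Disjoint (closure (Subtype.val '' U)) (Subtype.val '' V) := by
    rw [disjoint_image_right, ← Topology.IsInducing.subtypeVal.closure_eq_preimage_closure_image]
    exact hUV.closure_left hV
  rw [closure_union, hA.closure_eq, disjoint_union_left, disjoint_union_right, disjoint_union_right]
  refine ⟨⟨hclosure, disjoint_left.2 fun x hxU hxB => ?_⟩, ?_, hAB⟩
  · have hxY : x ∈ Y := closure_minimal (Subtype.coe_image_subset Y U) hY hxU
    exact disjoint_left.1 hclosure hxU ⟨⟨x, hxY⟩, hBV hxB, rfl⟩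
  · exact disjoint_image_right.2 (hUV.mono_left hAU)

theorem exists_extension [CompletelyNormalSpace X] {Y A B : Set X} (hY : IsClosed Y)
    (hA : IsClosed A) (hB : IsClosed B) (hAB : Disjoint A B) {L : Set Y}
    (hL : IsPartitionBetween L (Subtype.val ⁻¹' A) (Subtype.val ⁻¹' B)) :
    ∃ L', IsPartitionBetween L' A B ∧ Subtype.val ⁻¹' L' ⊆ L := by
  obtain ⟨-, U, V, hU, hV, hUV, hAU, hBV, hLc⟩ := hL
  obtain ⟨U', V', hU', hV', hUU', hVV', hUV'⟩ :
      SeparatedNhds (Subtype.val '' U ∪ A) (Subtype.val '' V ∪ B) :=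
    separatedNhds_iff_disjoint.2 <| completely_normal
      (disjoint_closure_image_val_union hY hA hAB hV hUV hAU hBV)
      (disjoint_closure_image_val_union hY hB hAB.symm hU hUV.symm hBV hAU).symm
  refine ⟨_, compl_union hU' hV' hUV' (subset_union_right.trans hUU')
    (subset_union_right.trans hVV'), ?_⟩
  rw [preimage_compl, compl_subset_comm, hLc, preimage_union]
  exact union_subset_union
    (image_subset_iff.1 (subset_union_left.trans hUU'))
    (image_subset_iff.1 (subset_union_left.trans hVV'))

end IsPartitionBetween

theorem isEssentialFamily_faces_of_finite (ι : Type*) [Finite ι] :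
    IsEssentialFamily (fun k : ι => {x : ι → I | x k = 0}) (fun k => {x | x k = 1}) := by
  refine ⟨isClosed_isClosed_disjoint_faces, fun L hL => ?_⟩
  have := Fintype.ofFinite ι
  choose _ U V hU hV hUV hAU hBV hLc using hL
  obtain ⟨p, hp⟩ := iInter_nonempty_of_forall_inter_ball_nonempty
    (F := Sum.elim (fun k => (U k)ᶜ) (fun k => (V k)ᶜ))
    (by simp [Sum.forall, hU, hV]) fun ε hε => by
      obtain ⟨N, hN⟩ := exists_nat_one_div_lt hε
      obtain ⟨v, hv⟩ := exists_Icc_inter_nonempty_diff_nonempty (N := N + 1)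
        (A := fun k => gridPoint (N + 1) ⁻¹' (U k)ᶜ)
        (fun k w hw => not_not_intro (hAU k (gridPoint_apply_eq_zero hw)))
        (fun k w hw =>
          (hUV k).subset_compl_left (hBV k (gridPoint_apply_eq_one N.succ_ne_zero hw)))
      have hball {w} (hw : w ∈ Icc v (v + 1)) :
          gridPoint (N + 1) w ∈ Metric.ball (gridPoint (N + 1) v) ε :=
        (dist_gridPoint_le hw).trans_lt (mod_cast hN)
      refine ⟨gridPoint (N + 1) v, Sum.forall.2 ⟨fun k => ?_, fun k => ?_⟩⟩
      · obtain ⟨w, hw, hwU⟩ := (hv k).1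
        exact ⟨_, hwU, hball hw⟩
      · obtain ⟨w, hw, hwU⟩ := (hv k).2
        exact ⟨_, (hUV k).subset_compl_right (not_not.1 hwU), hball hw⟩
  rw [iInter_sum] at hp
  refine ⟨p, mem_iInter.2 fun k => notMem_compl_iff.1 ?_⟩
  rw [hLc, mem_union, not_or]
  exact ⟨mem_iInter.1 hp.1 k, mem_iInter.1 hp.2 k⟩

theorem isEssentialFamily_faces (ι : Type*) :
    IsEssentialFamily (fun k : ι => {x : ι → I | x k = 0}) (fun k => {x | x k = 1}) := by
  classical
  refine ⟨isClosed_isClosed_disjoint_faces, fun L hL => ?_⟩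
  suffices h : ∀ s : Finset ι, (univ ∩ ⋂ k ∈ s, L k).Nonempty by
    simpa using isCompact_univ.inter_iInter_nonempty L (fun k => (hL k).1) h
  intro s
  let extend (x : s → I) (k : ι) : I := if hk : k ∈ s then x ⟨k, hk⟩ else 0
  have hextend : Continuous extend := continuous_pi fun k => by
    by_cases hk : k ∈ s <;> simp only [extend, hk, dite_true, dite_false] <;> fun_prop
  have hface (a : I) (k : s) : {x | x k = a} = extend ⁻¹' {x | x k = a} := by
    ext x; simp [extend]
  obtain ⟨x, hx⟩ := (isEssentialFamily_faces_of_finite s).2 (fun k => extend ⁻¹' L k) fun k => by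
    simpa only [hface] using (hL k).preimage hextend
  exact ⟨extend x, mem_univ _, mem_iInter₂.2 fun k hk => mem_iInter.1 hx ⟨k, hk⟩⟩

namespace IsEssentialFamily

variable {X ι κ : Type*} [TopologicalSpace X]

theorem comp_injective [NormalSpace X] {A B : ι → Set X} (h : IsEssentialFamily A B) {g : κ → ι}
    (hg : Function.Injective g) : IsEssentialFamily (A ∘ g) (B ∘ g) := by
  refine ⟨fun j => h.1 (g j), fun L hL => ?_⟩
  choose M hM using fun i =>
    IsPartitionBetween.exists_of_normalSpace (h.1 i).1 (h.1 i).2.1 (h.1 i).2.2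
  obtain ⟨x, hx⟩ := h.2 (Function.extend g L M) fun i => by
    by_cases hi : ∃ j, g j = i
    · obtain ⟨j, rfl⟩ := hi
      simpa only [Function.comp_apply, hg.extend_apply] using hL j
    · simpa only [Function.extend_apply' _ _ _ hi] using hM i
  refine ⟨x, mem_iInter.2 fun j => ?_⟩
  simpa only [hg.extend_apply] using mem_iInter.1 hx (g j)

theorem trace_inl [CompletelyNormalSpace X] {A B : ι ⊕ κ → Set X} (h : IsEssentialFamily A B)
    {M : κ → Set X} (hM : ∀ j, IsPartitionBetween (M j) (A (.inr j)) (B (.inr j))) :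
    IsEssentialFamily (X := ↥(⋂ j, M j)) (fun i => Subtype.val ⁻¹' A (.inl i))
      (fun i => Subtype.val ⁻¹' B (.inl i)) := by
  refine ⟨fun i => ?_, fun L hL => ?_⟩
  · obtain ⟨hA, hB, hAB⟩ := h.1 (.inl i)
    exact ⟨hA.preimage_val, hB.preimage_val, hAB.preimage _⟩
  · have hclosed : IsClosed (⋂ j, M j) := isClosed_iInter fun j => (hM j).1
    choose L' hL' hL'L using fun i => (hL i).exists_extension hclosed
      (h.1 (.inl i)).1 (h.1 (.inl i)).2.1 (h.1 (.inl i)).2.2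
    obtain ⟨x, hx⟩ := h.2 (Sum.elim L' M) (Sum.forall.2 ⟨hL', hM⟩)
    rw [iInter_sum] at hx
    exact ⟨⟨x, hx.2⟩, mem_iInter.2 fun i => hL'L i (mem_iInter.1 hx.1 i)⟩

end IsEssentialFamily

theorem StronglyInfiniteDimensional.infiniteDimensional {X : Type*} [TopologicalSpace X]
    [NormalSpace X] (h : StronglyInfiniteDimensional X) : InfiniteDimensional X := by
  obtain ⟨ι, A, B, _, hAB⟩ := h
  exact fun n => ⟨_, _, hAB.comp_injective
    ((Infinite.natEmbedding ι).injective.comp (Fin.val_injective (n := n)))⟩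

theorem subset_preimage_Iic_or_subset_preimage_Ici {X α : Type*} [TopologicalSpace X]
    [TopologicalSpace α] [Preorder α] [OrderClosedTopology α] {K : Set X} (hK : IsPreconnected K)
    {g : X → α} (hg : Continuous g) {a b : α} (hab : a < b) (hgap : ∀ x ∈ K, g x ≤ a ∨ b ≤ g x) :
    K ⊆ g ⁻¹' Iic a ∨ K ⊆ g ⁻¹' Ici b :=
  isPreconnected_iff_subset_of_disjoint_closed.1 hK _ _ (isClosed_Iic.preimage hg)
    (isClosed_Ici.preimage hg) hgap <| by
      rw [← preimage_inter, Iic_inter_Ici, Icc_eq_empty hab.not_ge, preimage_empty, inter_empty]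

theorem seventh_strictMono : StrictMono seventh := fun j k hjk => by
  rw [← Subtype.coe_lt_coe]
  simp only [seventh]
  gcongr
  exact hjk

section CrookedPartition

variable {y₁ y₂ y₃ y₄ : I}

theorem crookedPartition_eq (h₀ : 0 < y₁) (h₁ : y₁ < y₂) (h₂ : y₂ < y₃) (h₃ : y₃ < y₄)
    (h₄ : y₄ < 1) :
    crookedPartition y₁ y₂ y₃ y₄ =
      Icc (seventh 1) (seventh 2) ×ˢ Icc 0 y₄ ∪
      Icc (seventh 1) (seventh 4) ×ˢ Icc y₃ y₄ ∪
      Icc (seventh 3) (seventh 4) ×ˢ Icc y₁ y₄ ∪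
      Icc (seventh 3) (seventh 6) ×ˢ Icc y₁ y₂ ∪
      Icc (seventh 5) (seventh 6) ×ˢ Icc y₁ 1 := by
  have hs {j k : Fin 8} (h : j < k) : seventh j ≠ seventh k := (seventh_strictMono h).ne
  have h₁₄ : y₁ < y₄ := h₁.trans (h₂.trans h₃)
  simp only [crookedPartition, closure_union, closure_prod_eq]
  rw [closure_Ioo (hs (by decide)), closure_Ioo (hs (by decide)), closure_Ioo (hs (by decide)),
    closure_Ioo (hs (by decide)), closure_Ioo (hs (by decide)), closure_Ioo (h₀.trans h₁₄).ne,
    closure_Ioo h₃.ne, closure_Ioo h₁₄.ne, closure_Ioo h₁.ne, closure_Ioo (h₁₄.trans h₄).ne]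

theorem mem_crookedPartition (h₀ : 0 < y₁) (h₁ : y₁ < y₂) (h₂ : y₂ < y₃) (h₃ : y₃ < y₄)
    (h₄ : y₄ < 1) {p : I × I} :
    p ∈ crookedPartition y₁ y₂ y₃ y₄ ↔
      p.1 ∈ Icc (seventh 1) (seventh 2) ∧ p.2 ≤ y₄ ∨
      p.1 ∈ Icc (seventh 1) (seventh 4) ∧ p.2 ∈ Icc y₃ y₄ ∨
      p.1 ∈ Icc (seventh 3) (seventh 4) ∧ p.2 ∈ Icc y₁ y₄ ∨
      p.1 ∈ Icc (seventh 3) (seventh 6) ∧ p.2 ∈ Icc y₁ y₂ ∨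
      p.1 ∈ Icc (seventh 5) (seventh 6) ∧ y₁ ≤ p.2 := by
  simp only [crookedPartition_eq h₀ h₁ h₂ h₃ h₄, mem_union, mem_prod, mem_Icc, unitInterval.nonneg',
    unitInterval.le_one', true_and, and_true, or_assoc]

theorem isPartitionBetween_crookedPartition (h₀ : 0 < y₁) (h₁ : y₁ < y₂) (h₂ : y₂ < y₃)
    (h₃ : y₃ < y₄) (h₄ : y₄ < 1) :
    IsPartitionBetween (crookedPartition y₁ y₂ y₃ y₄) {p | p.1 = 0} {p | p.1 = 1} := by
  let left : Set (I × I) :=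
    Iio (seventh 1) ×ˢ univ ∪ Iio (seventh 5) ×ˢ Ioi y₄ ∪ Ioo (seventh 4) (seventh 5) ×ˢ Ioi y₂
  let right : Set (I × I) :=
    Ioi (seventh 6) ×ˢ univ ∪ Ioi (seventh 2) ×ˢ Iio y₁ ∪ Ioo (seventh 2) (seventh 3) ×ˢ Iio y₃
  have hs : seventh 0 < seventh 1 ∧ seventh 1 < seventh 2 ∧ seventh 2 < seventh 3 ∧
      seventh 3 < seventh 4 ∧ seventh 4 < seventh 5 ∧ seventh 5 < seventh 6 ∧
      seventh 6 < seventh 7 := by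
    simp [seventh_strictMono.lt_iff_lt]
  have hs₀ : seventh 0 = 0 := by ext; simp [seventh]
  have hs₇ : seventh 7 = 1 := by ext; simp [seventh]
  have hcompl : crookedPartition y₁ y₂ y₃ y₄ = (left ∪ right)ᶜ := by
    ext p
    simp only [mem_crookedPartition h₀ h₁ h₂ h₃ h₄, left, right, mem_compl_iff, mem_union, mem_prod,
      mem_Icc, mem_Ioo, mem_Iio, mem_Ioi, mem_univ]
    grind
  rw [hcompl]
  refine IsPartitionBetween.compl_union ?_ ?_ ?_ ?_ ?_
  · exact ((isOpen_Iio.prod isOpen_univ).union (isOpen_Iio.prod isOpen_Ioi)).union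
      (isOpen_Ioo.prod isOpen_Ioi)
  · exact ((isOpen_Ioi.prod isOpen_univ).union (isOpen_Ioi.prod isOpen_Iio)).union
      (isOpen_Ioo.prod isOpen_Iio)
  · refine disjoint_left.2 fun p hl hr => ?_
    simp only [left, right, mem_union, mem_prod, mem_Ioo, mem_Iio, mem_Ioi, mem_univ] at hl hr
    grind
  · intro p (hp : p.1 = 0)
    exact .inl (.inl ⟨by simpa [hp, ← hs₀] using hs.1, mem_univ _⟩)
  · intro p (hp : p.1 = 1)
    exact .inl (.inl ⟨by simpa [hp, ← hs₇] using hs.2.2.2.2.2.2, mem_univ _⟩)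

theorem crookedPartition_gaps (h₀ : 0 < y₁) (h₁ : y₁ < y₂) (h₂ : y₂ < y₃) (h₃ : y₃ < y₄)
    (h₄ : y₄ < 1) {p : I × I} (hp : p ∈ crookedPartition y₁ y₂ y₃ y₄) :
    (p.2 < y₁ → p.1 ≤ seventh 2) ∧ (p.2 < y₃ → p.1 ≤ seventh 2 ∨ seventh 3 ≤ p.1) ∧
      (y₂ < p.2 → p.1 ≤ seventh 4 ∨ seventh 5 ≤ p.1) ∧ (y₄ < p.2 → seventh 5 ≤ p.1) := by
  have hs : seventh 2 < seventh 3 ∧ seventh 3 < seventh 4 ∧ seventh 4 < seventh 5 := by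
    simp [seventh_strictMono.lt_iff_lt]
  rw [mem_crookedPartition h₀ h₁ h₂ h₃ h₄] at hp
  simp only [mem_Icc] at hp
  grind

end CrookedPartition

theorem IsPliableFamily.restrict {X ι : Type*} [TopologicalSpace X] {f : ι → C(X, I)}
    (hf : IsPliableFamily f) {Y : Set X} (hY : IsClosed Y) :
    IsPliableFamily fun i => (f i).restrict Y := by
  rintro C D F G ⟨hC, hD, hF, hG, hCD, hCF, hDG⟩ hCne hDne
  have hval := hY.isClosedEmbedding_subtypeVal
  have hdisj {S T : Set Y} (h : S ∩ T = ∅) : Subtype.val '' S ∩ Subtype.val '' T = ∅ := by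
    rw [← image_inter Subtype.val_injective, h, image_empty]
  obtain ⟨i, hiC, hiG, hiF, hiD⟩ := hf _ _ _ _
    ⟨hval.isClosedMap C hC, hval.isClosedMap D hD, hval.isClosedMap F hF, hval.isClosedMap G hG,
      hdisj hCD, hdisj hCF, hdisj hDG⟩ (hCne.image _) (hDne.image _)
  rw [image_image] at hiC hiD
  exact ⟨i, hiC, fun x hx => hiG x (mem_image_of_mem _ hx),
    fun x hx => hiF x (mem_image_of_mem _ hx), hiD⟩

theorem IsPliableFamily.exists_apply_eq {X ι : Type*} [TopologicalSpace X] [T1Space X]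
    {f : ι → C(X, I)} (hf : IsPliableFamily f) {K L : Set X} (hK : IsClosed K) (hL : IsClosed L)
    {p q : X} (hp : p ∈ K \ L) (hq : q ∈ L \ K) :
    ∃ i, f i p = 0 ∧ f i q = 1 ∧ (∀ x ∈ K, (f i x : ℝ) ≤ 1 / 2) ∧ ∀ x ∈ L, 1 / 2 ≤ (f i x : ℝ) := by
  obtain ⟨i, hip, hiK, hiL, hiq⟩ := hf {p} {q} L K
    ⟨isClosed_singleton, isClosed_singleton, hL, hK,
      singleton_inter_eq_empty.2 fun h : p = q => hp.2 (h ▸ hq.1), singleton_inter_eq_empty.2 hp.2,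
      singleton_inter_eq_empty.2 hq.2⟩ (singleton_nonempty p) (singleton_nonempty q)
  rw [image_singleton, singleton_eq_singleton_iff] at hip hiq
  exact ⟨i, hip, hiq, hiK, hiL⟩

theorem hereditarilyIndecomposable_of_isPliableFamily {X ι : Type*} [TopologicalSpace X]
    [CompactSpace X] [T2Space X] {y₁ y₂ y₃ y₄ : I} (h₀ : 0 < y₁) (h₁ : y₁ < y₂)
    (h₂ : (y₂ : ℝ) < 1 / 2) (h₃ : 1 / 2 < (y₃ : ℝ)) (h₄ : y₃ < y₄) (h₅ : y₄ < 1)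
    {f : ι → C(X, I)} (hf : IsPliableFamily f) {g : ι → X → I} (hg : ∀ i, Continuous (g i))
    (hgf : ∀ i x, (g i x, f i x) ∈ crookedPartition y₁ y₂ y₃ y₄) :
    HereditarilyIndecomposable X := by
  refine ⟨inferInstance, inferInstance, fun K L hK hKconn hL hLconn ⟨z, hzK, hzL⟩ => ?_⟩
  by_contra! h
  obtain ⟨p, hp⟩ := not_subset.1 h.1
  obtain ⟨q, hq⟩ := not_subset.1 h.2
  obtain ⟨i, hip, hiq, hiK, hiL⟩ := hf.exists_apply_eq hK.isClosed hL.isClosed hp hq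
  have hgap x :=
    crookedPartition_gaps h₀ h₁ (Subtype.coe_lt_coe.1 (h₂.trans h₃)) h₄ h₅ (hgf i x)
  have h₂₃ : seventh 2 < seventh 3 := seventh_strictMono (by decide)
  have h₄₅ : seventh 4 < seventh 5 := seventh_strictMono (by decide)
  have hK₂ : K ⊆ g i ⁻¹' Iic (seventh 2) := by
    refine (subset_preimage_Iic_or_subset_preimage_Ici hKconn.isPreconnected (hg i) h₂₃
      fun x hx => (hgap x).2.1 ((hiK x hx).trans_lt h₃)).resolve_right fun hge => ?_
    exact (h₂₃.trans_le (hge hp.1)).not_ge ((hgap p).1 (hip.trans_lt h₀))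
  have hL₅ : L ⊆ g i ⁻¹' Ici (seventh 5) := by
    refine (subset_preimage_Iic_or_subset_preimage_Ici hLconn.isPreconnected (hg i) h₄₅
      fun x hx => (hgap x).2.2.1 (h₂.trans_le (hiL x hx))).resolve_left fun hle => ?_
    exact ((hle hq.1).trans_lt h₄₅).not_ge ((hgap q).2.2.2 (h₅.trans_eq hiq.symm))
  exact ((seventh_strictMono (by decide)).trans_le (hL₅ hzL)).not_ge (hK₂ hzK)

section BingCompactum

variable (f : ℕ+ → C(HilbertCube, I))

theorem continuous_diagMap (i : ℕ+) : Continuous (diagMap f i) :=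
  (continuous_apply (2 * i)).prodMk (f i).continuous

theorem isClosed_bingCompactum {P : Set (I × I)} (hP : IsClosed P) :
    IsClosed (bingCompactum P f) :=
  isClosed_iInter fun i => hP.preimage (continuous_diagMap f i)

theorem isEssentialFamily_odd_faceTraces {P : Set (I × I)}
    (hP : IsPartitionBetween P {p | p.1 = 0} {p | p.1 = 1}) :
    IsEssentialFamily
      (fun k : {k : ℕ+ // Odd (k : ℕ)} => faceZeroTrace (bingCompactum P f) k)
      (fun k : {k : ℕ+ // Odd (k : ℕ)} => faceOneTrace (bingCompactum P f) k) := by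
  let oddOrDouble : {k : ℕ+ // Odd (k : ℕ)} ⊕ ℕ+ → ℕ+ := Sum.elim Subtype.val (2 * ·)
  have hinj : Function.Injective oddOrDouble :=
    Subtype.val_injective.sumElim (mul_right_injective 2) fun k i hki =>
      Nat.not_even_iff_odd.2 k.2 (by rw [hki, PNat.mul_coe]; exact even_two_mul _)
  exact ((isEssentialFamily_faces ℕ+).comp_injective hinj).trace_inl fun i =>
    hP.preimage (continuous_diagMap f i)

end BingCompactum

theorem infinite_odd_pnat : Infinite {k : ℕ+ // Odd (k : ℕ)} :=
  Infinite.of_injective (fun n : ℕ => ⟨⟨2 * n + 1, Nat.succ_pos _⟩, odd_two_mul_add_one n⟩)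
    fun m n h => by simpa using congrArg (fun k => (k.1 : ℕ)) h

theorem mainTheorem4
    (y₁ y₂ y₃ y₄ : I) (h₀ : 0 < y₁) (h₁ : y₁ < y₂) (h₂ : (y₂ : ℝ) < 1 / 2)
    (h₃ : 1 / 2 < (y₃ : ℝ)) (h₄ : y₃ < y₄) (h₅ : y₄ < 1)
    (f : ℕ+ → C(HilbertCube, I)) (hf : IsPliableFamily f)
    (X : Set HilbertCube) (hX : X = bingCompactum (crookedPartition y₁ y₂ y₃ y₄) f) :
    IsCompact X ∧ HereditarilyIndecomposable X ∧
      InfiniteDimensional X ∧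
      IsEssentialFamily
        (fun k : {k : ℕ+ // Odd (k : ℕ)} => faceZeroTrace X k)
        (fun k : {k : ℕ+ // Odd (k : ℕ)} => faceOneTrace X k) ∧
      StronglyInfiniteDimensional X := by
  have hclosed : IsClosed X := hX ▸ isClosed_bingCompactum f isClosed_closure
  have : CompactSpace X := isCompact_iff_compactSpace.1 hclosed.isCompact
  have hmem (i : ℕ+) (x : X) : diagMap f i x ∈ crookedPartition y₁ y₂ y₃ y₄ :=
    mem_iInter.1 (hX.le x.2) i
  have hindec : HereditarilyIndecomposable X :=
    hereditarilyIndecomposable_of_isPliableFamily h₀ h₁ h₂ h₃ h₄ h₅ (hf.restrict hclosed)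
      (fun i => (continuous_apply (2 * i)).comp continuous_subtype_val) hmem
  have hpartition : IsPartitionBetween (crookedPartition y₁ y₂ y₃ y₄) {p | p.1 = 0} {p | p.1 = 1} :=
    isPartitionBetween_crookedPartition h₀ h₁ (Subtype.coe_lt_coe.1 (h₂.trans h₃)) h₄ h₅
  have hess := isEssentialFamily_odd_faceTraces f hpartition
  rw [← hX] at hess
  have hstrong : StronglyInfiniteDimensional X := ⟨_, _, _, infinite_odd_pnat, hess⟩
  exact ⟨hclosed.isCompact, hindec, hstrong.infiniteDimensional, hess, hstrong⟩
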